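/- Let $(\Omega,\mathcal F,\mathbb P)$ be an atomless probability space, $\mathcal X:=L^\infty(\Omega,\mathcal F,\mathbb P)$, and let $X_1,\dots,X_n\in\mathcal X$ be the initial endowments of $n$ agents, with aggregate endowment $S:=\sum_{i=1}^n X_i$. Let $U_1,\dots,U_n:\mathcal X\to\mathbb R$ be the agents' utility functionals. An allocation is a vector $(Y_1,\dots,Y_n)\in\mathcal X^n$ with $\sum_{i=1}^n Y_i=S$. It is comonotone if there is an event $A$ with $\mathbb P(A)=1$ such that $[Y_i(\omega_1)-Y_i(\omega_2)]\,[Y_j(\omega_1)-Y_j(\omega_2)]\ge 0$ for all $\omega_1,\omega_2\in A$ and all $i,j$. It is individually rational if $U_i(Y_i)\ge U_i(X_i)$ for all $i$. A (comonotone) allocation $(Y_i^*)$ is called (comonotone) Pareto optimal if it is individually rational and there is no individually rational (comonotone) allocation $(Y_i)$ such that $U_i(Y_i)\ge U_i(Y_i^*)$ for all $i$, with at least one strict inequality. Let $\mathcal{PO}$ be the set of Pareto-optimal allocations and $\mathcal{CPO}$ the set of comonotone Pareto-optimal allocations (that is, comonotone allocations not dominated by any other individually rational comonotone allocation), and define $$\mathcal{UPF}:=\{(U_1(Y_1),\dots,U_n(Y_n))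 : (Y_i)\in\mathcal{PO}\},\qquad \mathcal{CUPF}:=\{(U_1(Y_1),\dots,U_n(Y_n)) : (Y_i)\in\mathcal{CPO}\}.$$ Suppose that for each $i$: - $U_i$ is concave; - $U_i$ is S.S.D. preserving, i.e. $U_i(Z_1)\le U_i(Z_2)$ whenever $Z_1,Z_2\in\mathcal X$ satisfy $\mathbb E[\phi(Z_1)]\le\mathbb E[\phi(Z_2)]$ for every increasing (that is, nondecreasing) concave function $\phi:\mathbb R\to\mathbb R$; - for every $Z\in\mathcal X$, the function $c\mapsto U_i(Z+c)$ from $\mathbb R$ to $\mathbb R$ is continuous, strictly increasing, and satisfies $\lim_{c\to\infty}U_i(Z+c)=\infty$. Then $\mathcal{UPF}=\mathcal{CUPF}$. -/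

import Mathlib

/-!
Every allocation `Y` has a comonotone allocation `Z` whose components dominate those of `Y` in the
concave order; both inclusions between the frontiers follow from this. To find `Z`, minimise
`∑ i, ‖Z i‖²` in `L²` over the closed convex set of all allocations dominating `Y` in this way, each
component confined to a compact interval. If, in the minimiser, some `Z i` and `Z j` moved in
opposite directions across levels `q` and `r`, a zero-mean transfer between agents `i` and `j`
would move `Z i` towards `q` and `Z j` towards `r`. Such a mean-preserving contraction is an
improvement in the concave order and decreases the second moment, contradicting minimality.
-/

open MeasureTheory Filter
open scoped ENNReal

namespace RiskSharing

/-- The measure has no atoms in the sense of measure theory: every measurable set of positive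
measure has a measurable subset of strictly smaller positive measure. -/
def Atomless {Ω : Type*} [MeasurableSpace Ω] (μ : Measure Ω) : Prop :=
  ∀ A : Set Ω, MeasurableSet A → 0 < μ A →
    ∃ B : Set Ω, B ⊆ A ∧ MeasurableSet B ∧ 0 < μ B ∧ μ B < μ A

/-- `Z₁ ≼ Z₂` in the increasing concave order (second-order stochastic dominance): for every
increasing concave `φ : ℝ → ℝ` one has `E[φ(Z₁)] ≤ E[φ(Z₂)]` when these expectations are defined.
(For essentially bounded `Z₁`, `Z₂` they always are, as a concave `φ : ℝ → ℝ` is continuous.) -/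
def ICVLe {Ω : Type*} [MeasurableSpace Ω] (μ : Measure Ω) (Z₁ Z₂ : Lp ℝ ∞ μ) : Prop :=
  ∀ φ : ℝ → ℝ, Monotone φ → ConcaveOn ℝ Set.univ φ →
    Integrable (fun ω => φ (Z₁ ω)) μ → Integrable (fun ω => φ (Z₂ ω)) μ →
      ∫ ω, φ (Z₁ ω) ∂μ ≤ ∫ ω, φ (Z₂ ω) ∂μ

/-- A functional on `L^∞` is S.S.D. preserving if it respects the increasing concave order. -/
def SSDPreserving {Ω : Type*} [MeasurableSpace Ω] (μ : Measure Ω) (U : Lp ℝ ∞ μ → ℝ) : Prop :=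
  ∀ Z₁ Z₂ : Lp ℝ ∞ μ, ICVLe μ Z₁ Z₂ → U Z₁ ≤ U Z₂

/-- For every `Z`, the function `c ↦ U (Z + c)` is continuous, strictly increasing, and tends to
infinity as `c → ∞`. -/
def CashRegular {Ω : Type*} [MeasurableSpace Ω] (μ : Measure Ω) [IsFiniteMeasure μ]
    (U : Lp ℝ ∞ μ → ℝ) : Prop :=
  ∀ Z : Lp ℝ ∞ μ,
    Continuous (fun c : ℝ => U (Z + Lp.const ∞ μ c)) ∧
    StrictMono (fun c : ℝ => U (Z + Lp.const ∞ μ c)) ∧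
    Tendsto (fun c : ℝ => U (Z + Lp.const ∞ μ c)) atTop atTop

/-- The set `𝒜` of allocations of the aggregate endowment `∑ i, X i`. -/
def Allocations {Ω : Type*} [MeasurableSpace Ω] (μ : Measure Ω) {n : ℕ}
    (X : Fin n → Lp ℝ ∞ μ) : Set (Fin n → Lp ℝ ∞ μ) :=
  {Y | ∑ i, Y i = ∑ i, X i}

/-- Comonotonicity of a random vector, for almost-everywhere classes: outside a null set, any two
components never move in opposite directions. -/
def Comonotone {Ω : Type*} [MeasurableSpace Ω] (μ : Measure Ω) {n : ℕ}
    (Y : Fin n → Lp ℝ ∞ μ) : Prop :=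
  ∃ A ∈ ae μ, ∀ ω₁ ∈ A, ∀ ω₂ ∈ A, ∀ i j : Fin n,
    0 ≤ (Y i ω₁ - Y i ω₂) * (Y j ω₁ - Y j ω₂)

/-- The set `𝒜_C` of comonotone allocations. -/
def ComonotoneAllocations {Ω : Type*} [MeasurableSpace Ω] (μ : Measure Ω) {n : ℕ}
    (X : Fin n → Lp ℝ ∞ μ) : Set (Fin n → Lp ℝ ∞ μ) :=
  {Y | Y ∈ Allocations μ X ∧ Comonotone μ Y}

/-- Individual rationality with respect to the initial endowments `X`. -/
def IndividuallyRational {Ω : Type*} [MeasurableSpace Ω] (μ : Measure Ω) {n : ℕ}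
    (U : Fin n → Lp ℝ ∞ μ → ℝ) (X Y : Fin n → Lp ℝ ∞ μ) : Prop :=
  ∀ i, U i (X i) ≤ U i (Y i)

/-- `Y` Pareto-dominates `Y'`: every agent is at least as well off, at least one strictly so. -/
def Dominates {Ω : Type*} [MeasurableSpace Ω] (μ : Measure Ω) {n : ℕ}
    (U : Fin n → Lp ℝ ∞ μ → ℝ) (Y Y' : Fin n → Lp ℝ ∞ μ) : Prop :=
  (∀ i, U i (Y' i) ≤ U i (Y i)) ∧ ∃ i, U i (Y' i) < U i (Y i)

/-- The set `PO` of Pareto-optimal allocations. -/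
def ParetoOptima {Ω : Type*} [MeasurableSpace Ω] (μ : Measure Ω) {n : ℕ}
    (U : Fin n → Lp ℝ ∞ μ → ℝ) (X : Fin n → Lp ℝ ∞ μ) : Set (Fin n → Lp ℝ ∞ μ) :=
  {Y | Y ∈ Allocations μ X ∧ IndividuallyRational μ U X Y ∧
    ¬ ∃ Y' ∈ Allocations μ X, IndividuallyRational μ U X Y' ∧ Dominates μ U Y' Y}

/-- The set `CPO` of comonotone Pareto-optimal allocations, i.e. those that are Pareto optimal in
the market where only comonotone allocations are admissible. -/
def ComonotoneParetoOptima {Ω : Type*} [MeasurableSpace Ω] (μ : Measure Ω) {n : ℕ}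
    (U : Fin n → Lp ℝ ∞ μ → ℝ) (X : Fin n → Lp ℝ ∞ μ) : Set (Fin n → Lp ℝ ∞ μ) :=
  {Y | Y ∈ ComonotoneAllocations μ X ∧ IndividuallyRational μ U X Y ∧
    ¬ ∃ Y' ∈ ComonotoneAllocations μ X, IndividuallyRational μ U X Y' ∧ Dominates μ U Y' Y}

/-- The utility possibility frontier. -/
def UPF {Ω : Type*} [MeasurableSpace Ω] (μ : Measure Ω) {n : ℕ}
    (U : Fin n → Lp ℝ ∞ μ → ℝ) (X : Fin n → Lp ℝ ∞ μ) : Set (Fin n → ℝ) :=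
  {u | ∃ Y ∈ ParetoOptima μ U X, ∀ i, u i = U i (Y i)}

/-- The comonotone utility possibility frontier. -/
def CUPF {Ω : Type*} [MeasurableSpace Ω] (μ : Measure Ω) {n : ℕ}
    (U : Fin n → Lp ℝ ∞ μ → ℝ) (X : Fin n → Lp ℝ ∞ μ) : Set (Fin n → ℝ) :=
  {u | ∃ Y ∈ ComonotoneParetoOptima μ U X, ∀ i, u i = U i (Y i)}

end RiskSharing

namespace RiskSharing

section Concave

variable {s : Set ℝ} {φ : ℝ → ℝ}

theorem exists_supergradient (hφ : ConcaveOn ℝ s φ) {m : ℝ} (hm : m ∈ interior s) :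
    ∃ σ : ℝ, ∀ y ∈ s, φ y ≤ φ m + σ * (y - m) := by
  have hψ : ConvexOn ℝ s (-φ) := hφ.neg
  refine ⟨-derivWithin (-φ) (Set.Ioi m) m, fun y hy => ?_⟩
  rcases lt_trichotomy m y with hmy | rfl | hym
  · have hslope := hψ.rightDeriv_le_slope_of_mem_interior hm hy hmy
    rw [slope_def_field, le_div_iff₀ (sub_pos.mpr hmy), Pi.neg_apply, Pi.neg_apply] at hslope
    linarith
  · simp
  · have hslope := (hψ.slope_le_leftDeriv_of_mem_interior hy hm hym).trans
      (hψ.leftDeriv_le_rightDeriv_of_mem_interior hm)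
    rw [slope_def_field, div_le_iff₀ (sub_pos.mpr hym), Pi.neg_apply, Pi.neg_apply] at hslope
    linarith

theorem exists_add_mul_sub_le_of_mem_uIcc (hφ : ConcaveOn ℝ s φ) {m : ℝ} (hm : m ∈ interior s) :
    ∃ σ : ℝ, ∀ z ∈ s, ∀ x ∈ Set.uIcc m z, φ z + σ * (x - z) ≤ φ x := by
  obtain ⟨σ, hσ⟩ := exists_supergradient hφ hm
  refine ⟨σ, fun z hz x hx => ?_⟩
  rw [← segment_eq_uIcc] at hx
  obtain ⟨a, b, ha, hb, hab, rfl⟩ := hx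
  have hconc : a * φ m + b * φ z ≤ φ (a • m + b • z) :=
    hφ.2 (interior_subset hm) hz ha hb hab
  have hsuper : a * φ z ≤ a * (φ m + σ * (z - m)) := mul_le_mul_of_nonneg_left (hσ z hz) ha
  obtain rfl : b = 1 - a := by linarith
  simp only [smul_eq_mul] at hconc ⊢
  linarith

end Concave

section ConcaveOrder

variable {Ω : Type*} [MeasurableSpace Ω] {μ : Measure Ω}

/-- The concave order on random variables: `E[φ(f)] ≤ E[φ(g)]` for every concave `φ : ℝ → ℝ` for
which both sides are defined. It differs from `ICVLe` in that `φ` need not be increasing, so that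
it can only relate integrable variables of equal mean. -/
def ConcaveLE (μ : Measure Ω) (f g : Ω → ℝ) : Prop :=
  ∀ φ : ℝ → ℝ, ConcaveOn ℝ Set.univ φ →
    Integrable (fun ω => φ (f ω)) μ → Integrable (fun ω => φ (g ω)) μ →
      ∫ ω, φ (f ω) ∂μ ≤ ∫ ω, φ (g ω) ∂μ

theorem ConcaveLE.icvLe {Z₁ Z₂ : Lp ℝ ∞ μ} (h : ConcaveLE μ Z₁ Z₂) : ICVLe μ Z₁ Z₂ :=
  fun φ _ hφ => h φ hφ

theorem ConcaveLE.refl (μ : Measure Ω) (f : Ω → ℝ) : ConcaveLE μ f f :=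
  fun _ _ _ _ => le_rfl

theorem ConcaveLE.congr {f f' g g' : Ω → ℝ} (h : ConcaveLE μ f g) (hf : f =ᵐ[μ] f')
    (hg : g =ᵐ[μ] g') : ConcaveLE μ f' g' := by
  intro φ hφ hf' hg'
  have hφf : (fun ω => φ (f ω)) =ᵐ[μ] fun ω => φ (f' ω) := hf.fun_comp φ
  have hφg : (fun ω => φ (g ω)) =ᵐ[μ] fun ω => φ (g' ω) := hg.fun_comp φ
  rw [← integral_congr_ae hφf, ← integral_congr_ae hφg]
  exact h φ hφ (hf'.congr hφf.symm) (hg'.congr hφg.symm)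

/-- `g` is obtained from `f` by moving its values towards the level `m` while preserving the
mean. -/
structure IsMeanContraction (μ : Measure Ω) (m : ℝ) (f g : Ω → ℝ) : Prop where
  mem_uIcc : ∀ᵐ ω ∂μ, g ω ∈ Set.uIcc m (f ω)
  integral_eq : ∫ ω, g ω ∂μ = ∫ ω, f ω ∂μ

namespace IsMeanContraction

variable {m : ℝ} {f g : Ω → ℝ}

theorem refl (μ : Measure Ω) (m : ℝ) (f : Ω → ℝ) : IsMeanContraction μ m f f :=
  ⟨.of_forall fun _ => Set.right_mem_uIcc, rfl⟩

theorem congr_right {g' : Ω → ℝ} (h : IsMeanContraction μ m f g) (hg : g =ᵐ[μ] g') :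
    IsMeanContraction μ m f g' :=
  ⟨by filter_upwards [h.mem_uIcc, hg] with ω hω hgg' using hgg' ▸ hω,
    (integral_congr_ae hg).symm.trans h.integral_eq⟩

theorem ae_mem (h : IsMeanContraction μ m f g) {K : Set ℝ} [K.OrdConnected] (hm : m ∈ K)
    (hf : ∀ᵐ ω ∂μ, f ω ∈ K) : ∀ᵐ ω ∂μ, g ω ∈ K := by
  filter_upwards [h.mem_uIcc, hf] with ω hg hf
  exact Set.OrdConnected.uIcc_subset inferInstance hm hf hg

theorem concaveLE (h : IsMeanContraction μ m f g) (hf : Integrable f μ) (hg : Integrable g μ) :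
    ConcaveLE μ f g := by
  intro φ hφ hφf hφg
  obtain ⟨σ, hσ⟩ := exists_add_mul_sub_le_of_mem_uIcc hφ (m := m) (by simp)
  have hlin : Integrable (fun ω => σ * (g ω - f ω)) μ := (hg.sub hf).const_mul σ
  calc ∫ ω, φ (f ω) ∂μ = ∫ ω, (φ (f ω) + σ * (g ω - f ω)) ∂μ := by
        rw [integral_add hφf hlin, integral_const_mul, integral_sub hg hf, h.integral_eq,
          sub_self, mul_zero, add_zero]
    _ ≤ ∫ ω, φ (g ω) ∂μ := by
        refine integral_mono_ae (hφf.add hlin) hφg ?_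
        filter_upwards [h.mem_uIcc] with ω hω
        exact hσ _ (Set.mem_univ _) _ hω

theorem norm_sq_add_norm_sub_sq_le [IsFiniteMeasure μ] {z w : Lp ℝ 2 μ}
    (h : IsMeanContraction μ m z w) : ‖w‖ ^ 2 + ‖z - w‖ ^ 2 ≤ ‖z‖ ^ 2 := by
  have hint (u : Lp ℝ 2 μ) : Integrable u μ := (Lp.memLp u).integrable one_le_two
  have hpointwise : ∀ᵐ ω ∂μ, m * (z ω - w ω) ≤ inner ℝ (w ω) ((z - w : Lp ℝ 2 μ) ω) := by
    filter_upwards [h.mem_uIcc, Lp.coeFn_sub z w] with ω hω hsub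
    rw [hsub, Pi.sub_apply, RCLike.inner_apply, conj_trivial]
    rcases Set.mem_uIcc.mp hω with ⟨hmw, hwz⟩ | ⟨hzw, hwm⟩ <;> nlinarith
  have hinner : 0 ≤ inner ℝ w (z - w) :=
    calc (0 : ℝ) = ∫ ω, m * (z ω - w ω) ∂μ := by
          rw [integral_const_mul, integral_sub (hint z) (hint w), h.integral_eq, sub_self,
            mul_zero]
      _ ≤ inner ℝ w (z - w) :=
          integral_mono_ae (((hint z).sub (hint w)).const_mul m)
            (L2.integrable_inner w (z - w)) hpointwise
  have hexpand := norm_add_sq_real w (z - w)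
  rw [add_sub_cancel] at hexpand
  linarith

end IsMeanContraction

end ConcaveOrder

section UpperSet

variable {Ω : Type*} [MeasurableSpace Ω] {μ : Measure Ω} {K : Set ℝ}

/-- The `K`-valued elements of `L^p` that dominate `f` in the concave order. -/
def concaveUpperSet (p : ℝ≥0∞) (μ : Measure Ω) (K : Set ℝ) (f : Ω → ℝ) : Set (Lp ℝ p μ) :=
  {z | (∀ᵐ ω ∂μ, z ω ∈ K) ∧ ConcaveLE μ f z}

variable [IsFiniteMeasure μ] {p : ℝ≥0∞} {f : Ω → ℝ}

theorem integrable_comp_of_ae_mem_isCompact {φ : ℝ → ℝ} (hφ : Continuous φ) (hK : IsCompact K)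
    (hf : AEStronglyMeasurable f μ) (hfK : ∀ᵐ ω ∂μ, f ω ∈ K) :
    Integrable (fun ω => φ (f ω)) μ := by
  obtain ⟨C, hC⟩ := hK.exists_bound_of_continuousOn hφ.continuousOn
  exact .of_bound (hφ.comp_aestronglyMeasurable hf) C (hfK.mono fun ω hω => hC _ hω)

theorem convex_concaveUpperSet (hK : IsCompact K) [K.OrdConnected] (f : Ω → ℝ) :
    Convex ℝ (concaveUpperSet p μ K f) := by
  rintro z₁ ⟨hz₁K, hz₁⟩ z₂ ⟨hz₂K, hz₂⟩ a b ha hb hab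
  have hcoe : ∀ᵐ ω ∂μ, (a • z₁ + b • z₂ : Lp ℝ p μ) ω = a • z₁ ω + b • z₂ ω := by
    filter_upwards [Lp.coeFn_add (a • z₁) (b • z₂), Lp.coeFn_smul a z₁, Lp.coeFn_smul b z₂]
      with ω hadd h₁ h₂
    rw [hadd, Pi.add_apply, h₁, h₂, Pi.smul_apply, Pi.smul_apply]
  refine ⟨?_, fun φ hφ hφf hφz => ?_⟩
  · filter_upwards [hcoe, hz₁K, hz₂K] with ω hω h₁ h₂
    rw [hω]
    exact Set.OrdConnected.convex inferInstance h₁ h₂ ha hb hab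
  have hφc := hφ.locallyLipschitz.continuous
  have hφz₁ := integrable_comp_of_ae_mem_isCompact hφc hK (Lp.aestronglyMeasurable z₁) hz₁K
  have hφz₂ := integrable_comp_of_ae_mem_isCompact hφc hK (Lp.aestronglyMeasurable z₂) hz₂K
  calc ∫ ω, φ (f ω) ∂μ = a * ∫ ω, φ (f ω) ∂μ + b * ∫ ω, φ (f ω) ∂μ := by
        rw [← add_mul, hab, one_mul]
    _ ≤ a * ∫ ω, φ (z₁ ω) ∂μ + b * ∫ ω, φ (z₂ ω) ∂μ :=
        add_le_add (mul_le_mul_of_nonneg_left (hz₁ φ hφ hφf hφz₁) ha)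
          (mul_le_mul_of_nonneg_left (hz₂ φ hφ hφf hφz₂) hb)
    _ = ∫ ω, (a * φ (z₁ ω) + b * φ (z₂ ω)) ∂μ := by
        rw [integral_add (hφz₁.const_mul a) (hφz₂.const_mul b), integral_const_mul,
          integral_const_mul]
    _ ≤ ∫ ω, φ ((a • z₁ + b • z₂ : Lp ℝ p μ) ω) ∂μ := by
        refine integral_mono_ae ((hφz₁.const_mul a).add (hφz₂.const_mul b)) hφz ?_
        filter_upwards [hcoe] with ω hω
        rw [hω]
        exact hφ.2 (Set.mem_univ _) (Set.mem_univ _) ha hb hab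

theorem isClosed_concaveUpperSet [Fact (1 ≤ p)] (hK : IsCompact K) (f : Ω → ℝ) :
    IsClosed (concaveUpperSet p μ K f) := by
  refine IsSeqClosed.isClosed fun u z hu hlim => ?_
  obtain ⟨ns, -, hns⟩ := (tendstoInMeasure_of_tendsto_Lp hlim).exists_seq_tendsto_ae
  have huK : ∀ᵐ ω ∂μ, ∀ k, u k ω ∈ K := ae_all_iff.mpr fun k => (hu k).1
  refine ⟨?_, fun φ hφ hφf _ => ?_⟩
  · filter_upwards [hns, huK] with ω hω hωK
    exact hK.isClosed.mem_of_tendsto hω (.of_forall fun k => hωK (ns k))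
  have hφc := hφ.locallyLipschitz.continuous
  obtain ⟨C, hC⟩ := hK.exists_bound_of_continuousOn hφc.continuousOn
  have hlimφ : Tendsto (fun k => ∫ ω, φ (u (ns k) ω) ∂μ) atTop (nhds (∫ ω, φ (z ω) ∂μ)) := by
    refine tendsto_integral_of_dominated_convergence (fun _ => C)
      (fun k => hφc.comp_aestronglyMeasurable (Lp.aestronglyMeasurable _))
      (integrable_const C) (fun k => ?_) ?_
    · filter_upwards [huK] with ω hω using hC _ (hω (ns k))
    · filter_upwards [hns] with ω hω using (hφc.tendsto _).comp hω
  exact ge_of_tendsto' hlimφ fun k => (hu (ns k)).2 φ hφ hφf <|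
    integrable_comp_of_ae_mem_isCompact hφc hK (Lp.aestronglyMeasurable _) (hu (ns k)).1

theorem IsMeanContraction.mem_concaveUpperSet [Fact (1 ≤ p)] {m : ℝ} {z w : Lp ℝ p μ}
    (h : IsMeanContraction μ m z w) (hK : IsCompact K) [K.OrdConnected] (hm : m ∈ K)
    (hz : z ∈ concaveUpperSet p μ K f) : w ∈ concaveUpperSet p μ K f := by
  have hint (u : Lp ℝ p μ) : Integrable u μ := (Lp.memLp u).integrable Fact.out
  refine ⟨h.ae_mem hm hz.1, fun φ hφ hφf hφw => ?_⟩
  have hφz := integrable_comp_of_ae_mem_isCompact hφ.locallyLipschitz.continuous hK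
    (Lp.aestronglyMeasurable z) hz.1
  exact (hz.2 φ hφ hφf hφz).trans (h.concaveLE (hint z) (hint w) φ hφ hφz hφw)

end UpperSet

section Comonotonicity

variable {Ω : Type*} [MeasurableSpace Ω] {μ : Measure Ω} {f g : Ω → ℝ}

theorem exists_mem_ae_monovaryOn
    (h : ∀ q r : ℝ, ¬ ((∃ᶠ ω in ae μ, q < f ω ∧ g ω < r) ∧ ∃ᶠ ω in ae μ, f ω < q ∧ r < g ω)) :
    ∃ A ∈ ae μ, MonovaryOn f g A := by
  have hpair (p : ℚ × ℚ) : ∃ A ∈ ae μ, ∀ ω₁ ∈ A, ∀ ω₂ ∈ A,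
      ¬ ((p.1 < f ω₁ ∧ g ω₁ < p.2) ∧ f ω₂ < p.1 ∧ p.2 < g ω₂) := by
    rcases not_and_or.mp (h p.1 p.2) with hA | hA <;> rw [not_frequently] at hA
    · exact ⟨_, hA, fun ω₁ h₁ _ _ hω => h₁ hω.1⟩
    · exact ⟨_, hA, fun _ _ ω₂ h₂ hω => h₂ hω.2⟩
  choose A hA hAcross using hpair
  refine ⟨⋂ p, A p, countable_iInter_mem.mpr hA, fun ω₁ h₁ ω₂ h₂ hg => ?_⟩
  by_contra! hf
  obtain ⟨q, hq₂, hq₁⟩ := exists_rat_btwn hf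
  obtain ⟨r, hr₁, hr₂⟩ := exists_rat_btwn hg
  rw [Set.mem_iInter] at h₁ h₂
  exact hAcross (q, r) ω₁ (h₁ _) ω₂ (h₂ _) ⟨⟨hq₁, hr₁⟩, hq₂, hr₂⟩

theorem comonotone_of_forall_exists_monovaryOn {n : ℕ} {f : Fin n → Ω → ℝ}
    {Y : Fin n → Lp ℝ ∞ μ} (hY : ∀ i, f i =ᵐ[μ] Y i)
    (h : ∀ i j, ∃ A ∈ ae μ, MonovaryOn (f i) (f j) A) : Comonotone μ Y := by
  choose A hA hmono using h
  refine ⟨{ω | ∀ i, f i ω = Y i ω} ∩ ⋂ i, ⋂ j, A i j, inter_mem (ae_all_iff.mpr hY) <|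
    countable_iInter_mem.mpr fun i => countable_iInter_mem.mpr (hA i),
    fun ω₁ ⟨hY₁, h₁⟩ ω₂ ⟨hY₂, h₂⟩ i j => ?_⟩
  simp only [Set.mem_iInter] at h₁ h₂
  rw [← hY₁ i, ← hY₁ j, ← hY₂ i, ← hY₂ j]
  exact monovaryOn_iff_forall_mul_nonneg.mp (hmono i j) (h₂ i j) (h₁ i j)

end Comonotonicity

section Transfer

/-- The amount by which both `x` exceeds `q` and `y` falls short of `r`: an agent holding `x` can
give this much to one holding `y` without either of them overshooting the level `q` or `r`. -/
def discordance (q r x y : ℝ) : ℝ := max 0 (min (x - q) (r - y))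

theorem discordance_pos_iff {q r x y : ℝ} : 0 < discordance q r x y ↔ q < x ∧ y < r := by
  simp [discordance]

theorem sub_discordance_mem_uIcc {q r x y a b : ℝ} (ha : a ∈ Set.Icc 0 1)
    (hb : b ∈ Set.Icc 0 1) :
    x - (a * discordance q r x y - b * discordance r q y x) ∈ Set.uIcc q x := by
  obtain ⟨ha₀, ha₁⟩ := ha
  obtain ⟨hb₀, hb₁⟩ := hb
  have hnonneg : 0 ≤ discordance q r x y := le_max_left _ _
  have hnonneg' : 0 ≤ discordance r q y x := le_max_left _ _
  rcases le_total q x with hqx | hxq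
  · have hle : discordance q r x y ≤ x - q := max_le (by linarith) (min_le_left _ _)
    have hzero : discordance r q y x = 0 := max_eq_left ((min_le_right _ _).trans (by linarith))
    rw [hzero, Set.mem_uIcc]
    exact .inl ⟨by nlinarith, by nlinarith⟩
  · have hzero : discordance q r x y = 0 := max_eq_left ((min_le_left _ _).trans (by linarith))
    have hle : discordance r q y x ≤ q - x := max_le (by linarith) (min_le_right _ _)
    rw [hzero, Set.mem_uIcc]
    exact .inr ⟨by nlinarith, by nlinarith⟩

theorem exists_mul_eq_mul {x y : ℝ} (hx : 0 < x) (hy : 0 < y) :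
    ∃ a b : ℝ, a ∈ Set.Icc 0 1 ∧ b ∈ Set.Icc 0 1 ∧ 0 < a ∧ a * x = b * y := by
  have hsum : 0 < x + y := add_pos hx hy
  refine ⟨y / (x + y), x / (x + y), ⟨by positivity, ?_⟩, ⟨by positivity, ?_⟩, by positivity,
    by ring⟩
  · exact div_le_one_of_le₀ (by linarith) hsum.le
  · exact div_le_one_of_le₀ (by linarith) hsum.le

variable {Ω : Type*} [MeasurableSpace Ω] {μ : Measure Ω} [IsFiniteMeasure μ] {p : ℝ≥0∞}
  {f g : Ω → ℝ} {q r : ℝ}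

theorem memLp_discordance (hf : MemLp f p μ) (hg : MemLp g p μ) (q r : ℝ) :
    MemLp (fun ω => discordance q r (f ω) (g ω)) p μ := by
  have hq : MemLp (f - fun _ => q) p μ := hf.sub (memLp_const q)
  have hr : MemLp ((fun _ => r) - g) p μ := (memLp_const r).sub hg
  exact (MemLp.zero (ε := ℝ)).sup (hq.inf hr)

theorem integral_discordance_pos (hf : Integrable f μ) (hg : Integrable g μ)
    (h : ∃ᶠ ω in ae μ, q < f ω ∧ g ω < r) : 0 < ∫ ω, discordance q r (f ω) (g ω) ∂μ := by
  have hint : Integrable (fun ω => discordance q r (f ω) (g ω)) μ :=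
    memLp_one_iff_integrable.mp <| memLp_discordance (memLp_one_iff_integrable.mpr hf)
      (memLp_one_iff_integrable.mpr hg) q r
  have hnonneg : 0 ≤ fun ω => discordance q r (f ω) (g ω) := fun _ => le_max_left _ _
  refine (integral_nonneg hnonneg).lt_of_ne' fun hzero => h ?_
  filter_upwards [(integral_eq_zero_iff_of_nonneg hnonneg hint).mp hzero] with ω hω hlt
  exact (discordance_pos_iff.mpr hlt).ne' hω

theorem exists_discordance_transfer (hp : 1 ≤ p) (hf : MemLp f p μ) (hg : MemLp g p μ)
    (hfg : ∃ᶠ ω in ae μ, q < f ω ∧ g ω < r) (hgf : ∃ᶠ ω in ae μ, f ω < q ∧ r < g ω) :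
    ∃ w : Ω → ℝ, MemLp w p μ ∧ ¬ w =ᵐ[μ] 0 ∧
      IsMeanContraction μ q f (f - w) ∧ IsMeanContraction μ r g (g + w) := by
  have hfi := hf.integrable hp
  have hgi := hg.integrable hp
  let d : Ω → ℝ := fun ω => discordance q r (f ω) (g ω)
  let e : Ω → ℝ := fun ω => discordance r q (g ω) (f ω)
  have hd : MemLp d p μ := memLp_discordance hf hg q r
  have he : MemLp e p μ := memLp_discordance hg hf r q
  obtain ⟨a, b, ha, hb, ha_pos, hab⟩ := exists_mul_eq_mul (integral_discordance_pos hfi hgi hfg)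
    (integral_discordance_pos hgi hfi (hgf.mono fun _ => And.symm))
  let w : Ω → ℝ := fun ω => a * d ω - b * e ω
  have hw : MemLp w p μ := (hd.const_mul a).sub (he.const_mul b)
  have hw_zero : ∫ ω, w ω ∂μ = 0 := by
    rw [integral_sub ((hd.integrable hp).const_mul a) ((he.integrable hp).const_mul b),
      integral_const_mul, integral_const_mul, hab, sub_self]
  refine ⟨w, hw, fun hw_ae => hfg ?_,
    ⟨.of_forall fun ω => sub_discordance_mem_uIcc ha hb, ?_⟩, ⟨.of_forall fun ω => ?_, ?_⟩⟩
  · filter_upwards [hw_ae] with ω hω hcross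
    have hd_pos : 0 < d ω := discordance_pos_iff.mpr hcross
    have he_zero : e ω = 0 := max_eq_left ((min_le_left _ _).trans (by linarith [hcross.2]))
    have hw_pos : 0 < a * d ω - b * e ω := by rw [he_zero]; nlinarith
    exact hw_pos.ne' hω
  · simp [integral_sub hfi (hw.integrable hp), hw_zero]
  · have hgw : (g + w) ω = g ω - (b * e ω - a * d ω) := by
      simp only [w, Pi.add_apply]
      ring
    rw [hgw]
    exact sub_discordance_mem_uIcc hb ha
  · simp [integral_add hgi (hw.integrable hp), hw_zero]

end Transfer

theorem exists_forall_norm_le_of_isClosed_convex {E : Type*} [NormedAddCommGroup E]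
    [InnerProductSpace ℝ E] [CompleteSpace E] {C : Set E} (hne : C.Nonempty) (hC : IsClosed C)
    (hconv : Convex ℝ C) : ∃ z ∈ C, ∀ w ∈ C, ‖z‖ ≤ ‖w‖ := by
  obtain ⟨z, hz, hmin⟩ := exists_norm_eq_iInf_of_complete_convex hne hC.isComplete hconv 0
  refine ⟨z, hz, fun w hw => ?_⟩
  have hbdd : BddBelow (Set.range fun v : C => ‖0 - (v : E)‖) :=
    ⟨0, Set.forall_mem_range.mpr fun _ => norm_nonneg _⟩
  simpa only [zero_sub, norm_neg] using hmin.trans_le (ciInf_le hbdd ⟨w, hw⟩)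

theorem mem_of_frequently_lt_of_frequently_gt {α β : Type*} [Preorder β] {l : Filter α}
    {f : α → β} {s : Set β} [s.OrdConnected] {q : β} (hs : ∀ᶠ x in l, f x ∈ s)
    (hlt : ∃ᶠ x in l, f x < q) (hgt : ∃ᶠ x in l, q < f x) : q ∈ s := by
  obtain ⟨x, hxq, hx⟩ := (hlt.and_eventually hs).exists
  obtain ⟨x', hqx', hx'⟩ := (hgt.and_eventually hs).exists
  exact Set.OrdConnected.out inferInstance hx hx' ⟨hxq.le, hqx'.le⟩

section Improvements

variable {Ω ι : Type*} [MeasurableSpace Ω] {μ : Measure Ω} [Fintype ι] {K : ι → Set ℝ}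
  {y : ι → Lp ℝ 2 μ}

/-- The redistributions of `∑ i, y i` whose `i`-th component is `K i`-valued and dominates `y i` in
the concave order. They are placed in the Hilbert sum of copies of `L²`, whose squared norm is the
total second moment. -/
def improvements (μ : Measure Ω) (K : ι → Set ℝ) (y : ι → Lp ℝ 2 μ) :
    Set (PiLp 2 fun _ : ι => Lp ℝ 2 μ) :=
  {Z | ∑ i, Z i = ∑ i, y i ∧ ∀ i, Z i ∈ concaveUpperSet 2 μ (K i) (y i)}

variable [IsFiniteMeasure μ]

theorem isClosed_improvements (hK : ∀ i, IsCompact (K i)) : IsClosed (improvements μ K y) := by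
  simp only [improvements, Set.ofPred_and, Set.ofPred_forall]
  exact (isClosed_eq (by fun_prop) continuous_const).inter <| isClosed_iInter fun i =>
    (isClosed_concaveUpperSet (hK i) _).preimage (by fun_prop)

variable [∀ i, (K i).OrdConnected]

theorem convex_improvements (hK : ∀ i, IsCompact (K i)) : Convex ℝ (improvements μ K y) := by
  rintro Z ⟨hZsum, hZ⟩ W ⟨hWsum, hW⟩ a b ha hb hab
  refine ⟨?_, fun i => convex_concaveUpperSet (hK i) _ (hZ i) (hW i) ha hb hab⟩
  simp only [PiLp.add_apply, PiLp.smul_apply, Finset.sum_add_distrib, ← Finset.smul_sum, hZsum,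
    hWsum, ← add_smul, hab, one_smul]

theorem eq_of_isMeanContraction_of_minimal (hK : ∀ i, IsCompact (K i))
    {Z W : PiLp 2 fun _ : ι => Lp ℝ 2 μ} (hZ : Z ∈ improvements μ K y)
    (hmin : ∀ V ∈ improvements μ K y, ‖Z‖ ≤ ‖V‖) (hsum : ∑ i, W i = ∑ i, Z i)
    (hW : ∀ i, ∃ m ∈ K i, IsMeanContraction μ m (Z i) (W i)) : W = Z := by
  choose m hmK hm using hW
  have hW_mem : W ∈ improvements μ K y :=
    ⟨hsum.trans hZ.1, fun i => (hm i).mem_concaveUpperSet (hK i) (hmK i) (hZ.2 i)⟩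
  have hdecrease : ‖W‖ ^ 2 + ‖Z - W‖ ^ 2 ≤ ‖Z‖ ^ 2 := by
    simp only [PiLp.norm_sq_eq_of_L2, ← Finset.sum_add_distrib]
    exact Finset.sum_le_sum fun i _ => (hm i).norm_sq_add_norm_sub_sq_le
  have hle : ‖Z‖ ^ 2 ≤ ‖W‖ ^ 2 := by gcongr; exact hmin W hW_mem
  have hdist : ‖Z - W‖ ^ 2 = 0 := le_antisymm (by linarith) (sq_nonneg _)
  exact (sub_eq_zero.mp (norm_eq_zero.mp (pow_eq_zero_iff two_ne_zero |>.mp hdist))).symm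

theorem not_frequently_discordant_of_minimal (hK : ∀ i, IsCompact (K i))
    {Z : PiLp 2 fun _ : ι => Lp ℝ 2 μ} (hZ : Z ∈ improvements μ K y)
    (hmin : ∀ V ∈ improvements μ K y, ‖Z‖ ≤ ‖V‖) {i j : ι} (hij : i ≠ j) (q r : ℝ) :
    ¬ ((∃ᶠ ω in ae μ, q < Z i ω ∧ Z j ω < r) ∧ ∃ᶠ ω in ae μ, Z i ω < q ∧ r < Z j ω) := by
  classical
  rintro ⟨hA, hB⟩
  obtain ⟨w, hw, hw_ne, hwi, hwj⟩ :=
    exists_discordance_transfer one_le_two (Lp.memLp (Z i)) (Lp.memLp (Z j)) hA hB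
  let v : Lp ℝ 2 μ := hw.toLp w
  have hvi : IsMeanContraction μ q (Z i) (Z i - v : Lp ℝ 2 μ) :=
    hwi.congr_right <| (Lp.coeFn_sub _ v).trans (.sub .rfl hw.coeFn_toLp) |>.symm
  have hvj : IsMeanContraction μ r (Z j) (Z j + v : Lp ℝ 2 μ) :=
    hwj.congr_right <| (Lp.coeFn_add _ v).trans (.add .rfl hw.coeFn_toLp) |>.symm
  let V : ι → Lp ℝ 2 μ := Pi.single j v - Pi.single i v
  have hV : WithLp.toLp 2 (fun k => Z k + V k) = Z := by
    refine eq_of_isMeanContraction_of_minimal hK hZ hmin ?_ fun k => ?_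
    · simp [V, Finset.sum_add_distrib]
    · change ∃ m ∈ K k, IsMeanContraction μ m (Z k) (Z k + V k : Lp ℝ 2 μ)
      rcases eq_or_ne k i with rfl | hki
      · have hq : q ∈ K k := mem_of_frequently_lt_of_frequently_gt (hZ.2 k).1
          (hB.mono fun _ => And.left) (hA.mono fun _ => And.left)
        refine ⟨q, hq, ?_⟩
        simpa [V, hij, ← sub_eq_add_neg] using hvi
      rcases eq_or_ne k j with rfl | hkj
      · have hr : r ∈ K k := mem_of_frequently_lt_of_frequently_gt (hZ.2 k).1
          (hA.mono fun _ => And.right) (hB.mono fun _ => And.right)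
        refine ⟨r, hr, ?_⟩
        simpa [V, hki] using hvj
      · obtain ⟨ω, -, hω⟩ := (hA.and_eventually (hZ.2 k).1).exists
        refine ⟨Z k ω, hω, ?_⟩
        simpa [V, hki, hkj] using IsMeanContraction.refl μ (Z k ω) (Z k)
  have hv : v = 0 := by simpa [V, hij] using congrArg (fun W => W i) hV
  exact hw_ne ((hw.toLp_eq_toLp_iff .zero).mp (hv.trans MemLp.zero.toLp_zero.symm))

theorem exists_comonotone_mem_improvements (hK : ∀ i, IsCompact (K i))
    (hy : ∀ i, ∀ᵐ ω ∂μ, y i ω ∈ K i) :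
    ∃ Z ∈ improvements μ K y, ∀ i j, ∃ A ∈ ae μ, MonovaryOn (Z i) (Z j) A := by
  have hne : (improvements μ K y).Nonempty :=
    ⟨WithLp.toLp 2 y, rfl, fun i => ⟨hy i, .refl μ _⟩⟩
  obtain ⟨Z, hZ, hmin⟩ := exists_forall_norm_le_of_isClosed_convex hne
    (isClosed_improvements hK) (convex_improvements hK)
  refine ⟨Z, hZ, fun i j => ?_⟩
  rcases eq_or_ne i j with rfl | hij
  · exact ⟨Set.univ, univ_mem, monovaryOn_self _ _⟩
  · exact exists_mem_ae_monovaryOn (not_frequently_discordant_of_minimal hK hZ hmin hij)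

end Improvements

section Frontier

variable {Ω : Type*} [MeasurableSpace Ω] {μ : Measure Ω} {n : ℕ} {X : Fin n → Lp ℝ ∞ μ}

theorem ae_mem_Icc_norm (f : Lp ℝ ∞ μ) : ∀ᵐ ω ∂μ, f ω ∈ Set.Icc (-‖f‖) ‖f‖ := by
  have hle : ∀ᵐ ω ∂μ, ‖f ω‖ₑ ≤ eLpNorm f ∞ μ := ae_le_eLpNormEssSup
  filter_upwards [hle] with ω hω
  rw [Set.mem_Icc, ← abs_le, Lp.norm_def, ← Real.norm_eq_abs, ← toReal_enorm]
  exact ENNReal.toReal_mono (Lp.eLpNorm_ne_top f) hω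

theorem coeFn_sum_ae_eq {ι E : Type*} [Fintype ι] [NormedAddCommGroup E] {p p' : ℝ≥0∞}
    {f : ι → Lp E p μ} {g : ι → Lp E p' μ} (h : ∀ i, f i =ᵐ[μ] g i) :
    (∑ i, f i : Lp E p μ) =ᵐ[μ] (∑ i, g i : Lp E p' μ) := by
  filter_upwards [Lp.coeFn_fun_finsetSum Finset.univ f, Lp.coeFn_fun_finsetSum Finset.univ g,
    ae_all_iff.mpr h] with ω hf hg hfg
  simp only [hf, hg, hfg]

theorem exists_comonotone_concaveLE [IsFiniteMeasure μ] {Y : Fin n → Lp ℝ ∞ μ}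
    (hY : Y ∈ Allocations μ X) :
    ∃ Z ∈ ComonotoneAllocations μ X, ∀ i, ConcaveLE μ (Y i) (Z i) := by
  have hY₂ (i) : MemLp (Y i) 2 μ := (Lp.memLp (Y i)).mono_exponent le_top
  obtain ⟨Z, ⟨hsum, hZ⟩, hcomon⟩ := exists_comonotone_mem_improvements (μ := μ)
    (K := fun i => Set.Icc (-‖Y i‖) ‖Y i‖) (y := fun i => (hY₂ i).toLp) (fun _ => isCompact_Icc)
    fun i => by
      filter_upwards [(hY₂ i).coeFn_toLp, ae_mem_Icc_norm (Y i)] with ω hω hmem using hω ▸ hmem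
  have hZ_top (i) : MemLp (Z i) ∞ μ := memLp_top_of_bound (Lp.aestronglyMeasurable _) ‖Y i‖
    ((hZ i).1.mono fun ω => abs_le.mpr)
  refine ⟨fun i => (hZ_top i).toLp, ⟨?_, ?_⟩, fun i => ?_⟩
  · refine Eq.trans (Lp.ext ?_) hY
    calc (∑ i, (hZ_top i).toLp : Lp ℝ ∞ μ)
        =ᵐ[μ] (∑ i, Z i : Lp ℝ 2 μ) := coeFn_sum_ae_eq fun i => (hZ_top i).coeFn_toLp
      _ = (∑ i, (hY₂ i).toLp : Lp ℝ 2 μ) := by rw [hsum]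
      _ =ᵐ[μ] (∑ i, Y i : Lp ℝ ∞ μ) := coeFn_sum_ae_eq fun i => (hY₂ i).coeFn_toLp
  · exact comonotone_of_forall_exists_monovaryOn (fun i => (hZ_top i).coeFn_toLp.symm) hcomon
  · exact (hZ i).2.congr (hY₂ i).coeFn_toLp (hZ_top i).coeFn_toLp.symm

theorem upf_eq_cupf_of_forall_exists_comonotone {U : Fin n → Lp ℝ ∞ μ → ℝ}
    (h : ∀ Y ∈ Allocations μ X, ∃ Z ∈ ComonotoneAllocations μ X, ∀ i, U i (Y i) ≤ U i (Z i)) :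
    UPF μ U X = CUPF μ U X := by
  ext u
  constructor
  · rintro ⟨Y, ⟨hY, hYrat, hYopt⟩, hu⟩
    obtain ⟨Z, hZ, hle⟩ := h Y hY
    have hZrat : IndividuallyRational μ U X Z := fun i => (hYrat i).trans (hle i)
    have heq (i) : U i (Y i) = U i (Z i) :=
      (hle i).eq_of_not_lt fun hlt => hYopt ⟨Z, hZ.1, hZrat, hle, i, hlt⟩
    refine ⟨Z, ⟨hZ, hZrat, ?_⟩, fun i => (hu i).trans (heq i)⟩
    rintro ⟨W, hW, hWrat, hWdom, i, hlt⟩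
    exact hYopt ⟨W, hW.1, hWrat, fun k => (heq k).trans_le (hWdom k), i, (heq i).trans_lt hlt⟩
  · rintro ⟨Y, ⟨hY, hYrat, hYopt⟩, hu⟩
    refine ⟨Y, ⟨hY.1, hYrat, ?_⟩, hu⟩
    rintro ⟨W, hW, hWrat, hWdom, i, hlt⟩
    obtain ⟨Z, hZ, hle⟩ := h W hW
    exact hYopt ⟨Z, hZ, fun k => (hWrat k).trans (hle k), fun k => (hWdom k).trans (hle k), i,
      hlt.trans_le (hle i)⟩

end Frontier

end RiskSharing

theorem corollary3p10_general {Ω : Type*} [MeasurableSpace Ω] (μ : Measure Ω) [IsFiniteMeasure μ]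
    {n : ℕ} (X : Fin n → Lp ℝ ∞ μ) (U : Fin n → Lp ℝ ∞ μ → ℝ)
    (hU : ∀ i, ∀ Z₁ Z₂ : Lp ℝ ∞ μ, RiskSharing.ConcaveLE μ Z₁ Z₂ → U i Z₁ ≤ U i Z₂) :
    RiskSharing.UPF μ U X = RiskSharing.CUPF μ U X := by
  refine RiskSharing.upf_eq_cupf_of_forall_exists_comonotone fun Y hY => ?_
  obtain ⟨Z, hZ, hle⟩ := RiskSharing.exists_comonotone_concaveLE hY
  exact ⟨Z, hZ, fun i => hU i _ _ (hle i)⟩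

theorem corollary3p10 {Ω : Type*} [MeasurableSpace Ω] (μ : Measure Ω) [IsProbabilityMeasure μ]
    (hμ : RiskSharing.Atomless μ) {n : ℕ} (X : Fin n → Lp ℝ ∞ μ) (U : Fin n → Lp ℝ ∞ μ → ℝ)
    (hconc : ∀ i, ConcaveOn ℝ Set.univ (U i))
    (hssd : ∀ i, RiskSharing.SSDPreserving μ (U i))
    (hcash : ∀ i, RiskSharing.CashRegular μ (U i)) :
    RiskSharing.UPF μ U X = RiskSharing.CUPF μ U X :=
  corollary3p10_general μ X U fun i _ _ h => hssd i _ _ h.icvLe
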